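/- Let $k$ be an algebraically closed field of characteristic zero and let $R=k[x_0,x_1,y_0,y_1]$ be the $\mathbb N^2$-graded coordinate ring of $\mathbb P^1\times\mathbb P^1$, with $\deg x_i=(1,0)$ and $\deg y_i=(0,1)$. For $P,Q\in\mathbb P^1$ let $L_P$ be the form of degree $(1,0)$ vanishing at the points with first coordinate $P$, let $L_Q$ be the form of degree $(0,1)$ vanishing at the points with second coordinate $Q$, and put $I_{P\times Q}=(L_P,L_Q)$. For a set of fat points $Z=\sum_j m_jX_j$ (distinct points $X_j\in\mathbb P^1\times\mathbb P^1$, integers $m_j\ge1$) put $I_Z=\bigcap_j I_{X_j}^{m_j}$. A separator of $X_i$ of multiplicity $m_i$ is an $F\in I_{X_i}^{m_i-1}\setminus I_{X_i}^{m_i}$ with $F\in I_{X_j}^{m_j}$ for all $j\ne i$. Let $Z'$ be obtained from $Z$ by reducing the multiplicity of $X_i$ by one. Elements $F_1,\dots,F_n\in R$ form a set of minimal separators of $X_i$ of multiplicity $m_i$ if their classes generate $I_{Z'}/I_Z$ and no family of fewer than $n$ elements has this property. If $F_1,\dots,F_n$ are moreover bihomogeneous, the tuple $(\deg F_1,\dots,\deg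 F_n)$, up to order, is their degree. **Theorem.** Let $P\in\mathbb P^1$, let $Q_1,\dots,Q_b\in\mathbb P^1$ be distinct, let $m_1,\dots,m_b$ be positive integers, and let $Z=\sum_{p=1}^b m_p(P\times Q_p)$. Fix $i\in\{1,\dots,b\}$ and set $b_\ell=\sum_{p=1}^b(m_p-\ell)_+$, where $(t)_+=\max\{0,t\}$. Then bihomogeneous minimal separators of $P\times Q_i$ of multiplicity $m_i$ exist, and every set of them has degree, counted with multiplicity, $$\deg_Z(P\times Q_i)=\{(\ell,b_\ell-1)\mid \ell=0,\dots,m_i-1\}.$$ Explicitly, the forms $$F_\ell=L_P^{\ell}\,L_{Q_i}^{m_i-\ell-1}\prod_{p\ne i}L_{Q_p}^{(m_p-\ell)_+},\qquad \ell=0,\dots,m_i-1,$$ are separators of $P\times Q_i$ of multiplicity $m_i$, have degrees $\deg F_\ell=(\ell,b_\ell-1)$, and form a set of minimal separators. Symmetrically, for $Z=\sum_{p=1}^b m_p(Q_p\times P)$, bihomogeneous minimal separators of $Q_i\times P$ of multiplicity $m_i$ exist, every set of them has degree $\{(b_\ell-1,\ell)\mid\ell=0,\dots,m_i-1\}$,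 counted with multiplicity, and the same products, now with $L_P$ of degree $(0,1)$ and the $L_{Q_p}$ of degree $(1,0)$, are separators of degrees $(b_\ell-1,\ell)$ that form a set of minimal separators. -/

import Mathlib

namespace P1xP1

noncomputable section

/-- The projective line over `k`. -/
abbrev Line (k : Type*) [Field k] : Type _ := Projectivization k (Fin 2 → k)

/-- The coordinate ring `k[x₀, x₁, y₀, y₁]`, with `xᵢ = X (Sum.inl i)` and `yᵢ = X (Sum.inr i)`. -/
abbrev CoordRing (k : Type*) [Field k] : Type _ := MvPolynomial (Fin 2 ⊕ Fin 2) k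

/-- The bidegrees of the variables: `deg xᵢ = (1, 0)` and `deg yᵢ = (0, 1)`. -/
def bidegree : Fin 2 ⊕ Fin 2 → ℕ × ℕ :=
  Sum.elim (fun _ => (1, 0)) (fun _ => (0, 1))

/-- `F` is bihomogeneous of bidegree `d`. -/
def IsBihomogeneous {k : Type*} [Field k] (F : CoordRing k) (d : ℕ × ℕ) : Prop :=
  MvPolynomial.IsWeightedHomogeneous bidegree F d

/-- The form `L_P` of degree `(1, 0)` (unique up to a nonzero scalar) that vanishes at the points
with first coordinate `P`. -/
def formX {k : Type*} [Field k] (P : Line k) : CoordRing k :=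
  MvPolynomial.C (P.rep 1) * MvPolynomial.X (Sum.inl 0)
    - MvPolynomial.C (P.rep 0) * MvPolynomial.X (Sum.inl 1)

/-- The form `L_Q` of degree `(0, 1)` (unique up to a nonzero scalar) that vanishes at the points
with second coordinate `Q`. -/
def formY {k : Type*} [Field k] (Q : Line k) : CoordRing k :=
  MvPolynomial.C (Q.rep 1) * MvPolynomial.X (Sum.inr 0)
    - MvPolynomial.C (Q.rep 0) * MvPolynomial.X (Sum.inr 1)

theorem formX_isBihomogeneous {k : Type*} [Field k] (P : Line k) :
    IsBihomogeneous (formX P) (1, 0) := by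
  have h : ∀ (c : k) (i : Fin 2), MvPolynomial.IsWeightedHomogeneous bidegree
      (MvPolynomial.C c * MvPolynomial.X (Sum.inl i) : CoordRing k) (1, 0) := by
    intro c i
    have := (MvPolynomial.isWeightedHomogeneous_C bidegree c).mul
      (MvPolynomial.isWeightedHomogeneous_X k bidegree (Sum.inl i))
    simpa [bidegree] using this
  exact (MvPolynomial.weightedHomogeneousSubmodule k bidegree (1, 0)).sub_mem (h _ _) (h _ _)

theorem formY_isBihomogeneous {k : Type*} [Field k] (Q : Line k) :
    IsBihomogeneous (formY Q) (0, 1) := by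
  have h : ∀ (c : k) (i : Fin 2), MvPolynomial.IsWeightedHomogeneous bidegree
      (MvPolynomial.C c * MvPolynomial.X (Sum.inr i) : CoordRing k) (0, 1) := by
    intro c i
    have := (MvPolynomial.isWeightedHomogeneous_C bidegree c).mul
      (MvPolynomial.isWeightedHomogeneous_X k bidegree (Sum.inr i))
    simpa [bidegree] using this
  exact (MvPolynomial.weightedHomogeneousSubmodule k bidegree (0, 1)).sub_mem (h _ _) (h _ _)

theorem line_eq_iff {k : Type*} [Field k] (P Q : Line k) :
    P.rep 1 * Q.rep 0 - P.rep 0 * Q.rep 1 = 0 ↔ Q = P := by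
  constructor
  · intro h
    rw [← Q.mk_rep, ← P.mk_rep, Projectivization.mk_eq_mk_iff']
    have hP := P.rep_nonzero
    have hcase : P.rep 0 ≠ 0 ∨ P.rep 1 ≠ 0 := by
      by_contra! hc
      exact hP (by ext j; fin_cases j <;> simp [hc.1, hc.2])
    rcases hcase with h0 | h1
    · refine ⟨Q.rep 0 / P.rep 0, ?_⟩
      ext j
      fin_cases j
      · simp [h0]
      · simp only [Fin.mk_one, Pi.smul_apply, smul_eq_mul]
        field_simp
        linear_combination h
    · refine ⟨Q.rep 1 / P.rep 1, ?_⟩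
      ext j
      fin_cases j
      · simp only [Fin.zero_eta, Pi.smul_apply, smul_eq_mul]
        field_simp
        linear_combination -h
      · simp [h1]
  · rintro rfl
    ring

/-- `L_P` vanishes at a point exactly when that point has first coordinate `P`. -/
theorem eval_formX_eq_zero_iff {k : Type*} [Field k] (P Q S : Line k) :
    MvPolynomial.eval (Sum.elim Q.rep S.rep) (formX P) = 0 ↔ Q = P := by
  simpa [formX] using line_eq_iff P Q

/-- `L_Q` vanishes at a point exactly when that point has second coordinate `Q`. -/
theorem eval_formY_eq_zero_iff {k : Type*} [Field k] (P Q S : Line k) :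
    MvPolynomial.eval (Sum.elim S.rep Q.rep) (formY P) = 0 ↔ Q = P := by
  simpa [formY] using line_eq_iff P Q

/-- The ideal `I_{P × Q} = (L_P, L_Q)` of the point `P × Q`. -/
def pointIdeal {k : Type*} [Field k] (p : Line k × Line k) : Ideal (CoordRing k) :=
  Ideal.span {formX p.1, formY p.2}

/-- A set of fat points `Z = ∑ m_p p` of `ℙ¹ × ℙ¹`, as a formal sum of points with multiplicities;
its support is the finite set of points of nonzero multiplicity. -/
abbrev FatPoints (k : Type*) [Field k] : Type _ := (Line k × Line k) →₀ ℕ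

/-- The ideal `I_Z`: the intersection of the ideals `I_p ^ m_p` over the support of `Z`. -/
def fatIdeal {k : Type*} [Field k] (Z : FatPoints k) : Ideal (CoordRing k) :=
  ⨅ p ∈ Z.support, pointIdeal p ^ Z p

/-- `F` is a separator of the point `p` of multiplicity `Z p`. -/
def IsSeparator {k : Type*} [Field k] (Z : FatPoints k) (p : Line k × Line k)
    (F : CoordRing k) : Prop :=
  F ∈ pointIdeal p ^ (Z p - 1) ∧ F ∉ pointIdeal p ^ Z p ∧
    ∀ q ∈ Z.support, q ≠ p → F ∈ pointIdeal q ^ Z q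

/-- The fat points `Z'`: the multiplicity of `p` in `Z` is reduced by one. -/
def reduceAt {k : Type*} [Field k] (Z : FatPoints k) (p : Line k × Line k) : FatPoints k :=
  Z - Finsupp.single p 1

/-- The classes of the members of the family `F` generate the ideal `I_{Z'} / I_Z` of `R / I_Z`. -/
def GeneratesSeparators {k : Type*} [Field k] (Z : FatPoints k) (p : Line k × Line k) {n : ℕ}
    (F : Fin n → CoordRing k) : Prop :=
  Ideal.span (Set.range fun j => Ideal.Quotient.mk (fatIdeal Z) (F j)) =
    (fatIdeal (reduceAt Z p)).map (Ideal.Quotient.mk (fatIdeal Z))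

/-- `F₁, …, Fₙ` is a set of minimal separators of `p` of multiplicity `Z p`: the classes generate
`I_{Z'} / I_Z`, and no smaller number of elements does. -/
def IsMinimalSeparators {k : Type*} [Field k] (Z : FatPoints k) (p : Line k × Line k) {n : ℕ}
    (F : Fin n → CoordRing k) : Prop :=
  GeneratesSeparators Z p F ∧
    ∀ (q : ℕ) (G : Fin q → CoordRing k), q < n → ¬ GeneratesSeparators Z p G

/-- `D` is the tuple (up to order) of the degrees of some set of bihomogeneous minimal separators
of `p` of multiplicity `Z p`. -/
def IsSeparatorDegree {k : Type*} [Field k] (Z : FatPoints k) (p : Line k × Line k)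
    (D : Multiset (ℕ × ℕ)) : Prop :=
  ∃ (n : ℕ) (F : Fin n → CoordRing k) (d : Fin n → ℕ × ℕ),
    IsMinimalSeparators Z p F ∧ (∀ j, IsBihomogeneous (F j) (d j)) ∧
      D = (Finset.univ : Finset (Fin n)).val.map d

end

end P1xP1

/-! A linear change of the `x`-variables turns `L_P` into the variable of a polynomial ring `A[X]`,
where `A` is a polynomial ring in three variables, and each `L_{Q_p}` into a constant `n_p`, with
the `n_p` pairwise coprime. By `mem_span_X_C_pow_iff`, lying in `(X, n)^m` is a condition on each
coefficient separately: `n^(m - a)` divides the coefficient of `X^a`. So `I_Z` and `I_{Z'}`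
prescribe, degree by degree in `X`, a product of powers of the `n_p`, and differ by one factor `n_i`
in the degrees `ℓ < m_i`. The forms `F_ℓ` generate the quotient, and a relation `∑ r_ℓ F_ℓ ∈ I_Z`
forces every `r_ℓ` into `(L_P, L_{Q_i})`, hence to have zero constant term
(`mem_span_of_sum_mem_span_X_C_pow`).

Minimality and uniqueness of degrees follow from this independence alone
(`minimalSeparators_of_independent`). Writing the `F_ℓ` through another generating family and back
gives matrices of constant terms with product `1`, so no family is shorter. For a family of equal
length, a nonzero Leibniz term of the determinant matches its members with the `F_ℓ`, and rescaling
the variables shows that matched members have equal degree. -/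

open Polynomial in
theorem coeff_dvd_of_mem_span_X_C_pow {A : Type*} [CommRing A] (n : A) (m : ℕ) (f : A[X])
    (hf : f ∈ Ideal.span {(X : A[X]), C n} ^ m) (a : ℕ) : n ^ (m - a) ∣ f.coeff a := by
  induction m generalizing f a with
  | zero => simp
  | succ m ih =>
    rw [pow_succ] at hf
    induction hf using Submodule.mul_induction_on' with
    | mem_mul_mem g hg h hh =>
      obtain ⟨u, v, rfl⟩ := Ideal.mem_span_pair.1 hh
      have e : g * (u * X + v * C n) = (g * u) * X + (g * v) * C n := by ring
      rw [e, coeff_add, coeff_mul_C]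
      refine dvd_add ?_ ?_
      · cases a with
        | zero => simp
        | succ a =>
          rw [coeff_mul_X, Nat.add_sub_add_right]
          exact ih _ (Ideal.mul_mem_right _ _ hg) a
      -- Truncated subtraction makes this only an inequality: for `a > m` the left side is `0` and
      -- the right side is `1`.
      · refine (pow_dvd_pow n (show m + 1 - a ≤ m - a + 1 by omega)).trans ?_
        rw [pow_succ]
        exact mul_dvd_mul_right (ih _ (Ideal.mul_mem_right _ _ hg) a) n
    | add x _ y _ hx hy => rw [coeff_add]; exact dvd_add hx hy

theorem pow_mul_pow_mem_span_pair_pow {R : Type*} [CommRing R] (L N : R) {m a c : ℕ}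
    (h : m ≤ a + c) : L ^ a * N ^ c ∈ Ideal.span {L, N} ^ m := by
  refine Ideal.pow_le_pow_right h ?_
  rw [pow_add]
  exact Ideal.mul_mem_mul (Ideal.pow_mem_pow (Ideal.subset_span (by simp)) _)
    (Ideal.pow_mem_pow (Ideal.subset_span (by simp)) _)

-- The ideal is spanned over `A` by the terms `n^(m - a) X^a` and their multiples, so membership can
-- be tested one power of `X` at a time.
open Polynomial in
theorem mem_span_X_C_pow_iff {A : Type*} [CommRing A] (n : A) (m : ℕ) (f : A[X]) :
    f ∈ Ideal.span {(X : A[X]), C n} ^ m ↔ ∀ a, n ^ (m - a) ∣ f.coeff a := by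
  refine ⟨fun hf a => coeff_dvd_of_mem_span_X_C_pow n m f hf a, fun h => ?_⟩
  rw [f.as_sum_range_C_mul_X_pow]
  refine Ideal.sum_mem _ fun a _ => ?_
  obtain ⟨c, hc⟩ := h a
  have e : C (f.coeff a) * X ^ a = C c * (X ^ a * C n ^ (m - a)) := by
    rw [hc, C_mul, C_pow]; ring
  rw [e]
  exact Ideal.mul_mem_left _ _ (pow_mul_pow_mem_span_pair_pow _ _ (by omega))

open Polynomial in
/-- An element of the intersection of the ideals `(X, n_q) ^ (m_q - δ_{qi})` is a combination of
products `X ^ ℓ * ∏ n_q ^ _`, modulo the intersection of the `(X, n_q) ^ m_q`. -/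
theorem exists_sub_sum_mem_iInf_span_X_C {A : Type*} [CommRing A] [IsDomain A]
    [UniqueFactorizationMonoid A] {b : ℕ} (n : Fin b → A)
    (hn : Pairwise fun p q => IsRelPrime (n p) (n q)) (m : Fin b → ℕ) (i : Fin b) (f : A[X])
    (hf : ∀ q, f ∈ Ideal.span {(X : A[X]), C (n q)} ^ (if q = i then m q - 1 else m q)) :
    ∃ r : Fin (m i) → A[X], ∀ q, f - ∑ ℓ, r ℓ * (X ^ (ℓ : ℕ) *
      ∏ p, C (n p) ^ (if p = i then m p - (ℓ : ℕ) - 1 else m p - (ℓ : ℕ))) ∈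
        Ideal.span {(X : A[X]), C (n q)} ^ m q := by
  -- Coprimality merges the divisibility conditions of the separate points into one, whose modulus
  -- is the constant factor of `F_ℓ`.
  have key : ∀ ℓ, ∏ p, n p ^ (if p = i then m p - ℓ - 1 else m p - ℓ) ∣ f.coeff ℓ := by
    intro ℓ
    refine Finset.prod_dvd_of_isRelPrime (fun p _ q _ hpq => (hn hpq).pow) fun p _ => ?_
    have := (mem_span_X_C_pow_iff _ _ _).1 (hf p) ℓ
    split_ifs at this ⊢
    · rwa [Nat.sub_right_comm]
    · exact this
  choose c hc using key
  refine ⟨fun ℓ => C (c ℓ), fun q => (mem_span_X_C_pow_iff _ _ _).2 fun a => ?_⟩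
  have hs : ∀ ℓ : Fin (m i), C (c ℓ) * (X ^ (ℓ : ℕ) *
      ∏ p, C (n p) ^ (if p = i then m p - (ℓ : ℕ) - 1 else m p - (ℓ : ℕ))) =
      C (f.coeff ℓ) * X ^ (ℓ : ℕ) := by
    intro ℓ
    rw [hc ℓ, C_mul, map_prod]
    simp only [C_pow]
    ring
  simp only [hs, coeff_sub, finsetSum_coeff, coeff_C_mul_X_pow]
  by_cases ha : a < m i
  · rw [Finset.sum_eq_single (⟨a, ha⟩ : Fin (m i))]
    · simp
    · intro ℓ _ hℓ
      rw [if_neg]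
      rintro rfl
      exact hℓ rfl
    · simp
  · rw [Finset.sum_eq_zero, sub_zero]
    -- From degree `m i` on, the point `i` imposes no condition, so nothing has to be subtracted.
    · have := (mem_span_X_C_pow_iff _ _ _).1 (hf q) a
      split_ifs at this with hq
      · subst hq
        rw [Nat.sub_eq_zero_of_le (not_lt.1 ha)]
        simp
      · exact this
    · intro ℓ _
      rw [if_neg]
      rintro rfl
      exact ha ℓ.2

-- Compare coefficients of `X^ℓ` modulo `n_i^(m_i - ℓ)`: terms with `j > ℓ` do not reach this
-- degree, those with `j < ℓ` already carry enough factors `n_i`, and the term `j = ℓ` lacks exactly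
-- one. Its missing factor must come from the constant coefficient of `r ℓ`, since the other `n_p`
-- are coprime to `n_i`.
open Polynomial in
theorem mem_span_of_sum_mem_span_X_C_pow {A : Type*} [CommRing A] [IsDomain A]
    [UniqueFactorizationMonoid A] {b : ℕ} (n : Fin b → A)
    (hn : Pairwise fun p q => IsRelPrime (n p) (n q)) (m : Fin b → ℕ) (i : Fin b)
    (hi : n i ≠ 0) (r : Fin (m i) → A[X])
    (hr : ∑ ℓ, r ℓ * (X ^ (ℓ : ℕ) *
      ∏ p, C (n p) ^ (if p = i then m p - (ℓ : ℕ) - 1 else m p - (ℓ : ℕ))) ∈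
        Ideal.span {(X : A[X]), C (n i)} ^ m i) (ℓ : Fin (m i)) :
    r ℓ ∈ Ideal.span {(X : A[X]), C (n i)} := by
  have hprod : ∀ a : ℕ, ∏ p, n p ^ (if p = i then m p - a - 1 else m p - a) =
      n i ^ (m i - a - 1) * ∏ p ∈ Finset.univ.erase i, n p ^ (m p - a) := by
    intro a
    rw [← Finset.mul_prod_erase _ _ (Finset.mem_univ i), if_pos rfl]
    congr 1
    refine Finset.prod_congr rfl fun p hp => ?_
    rw [if_neg (Finset.ne_of_mem_erase hp)]
  have h := (mem_span_X_C_pow_iff _ _ _).1 hr ℓ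
  have hs : ∀ j : Fin (m i), r j * (X ^ (j : ℕ) *
      ∏ p, C (n p) ^ (if p = i then m p - (j : ℕ) - 1 else m p - (j : ℕ))) =
      r j * C (n i ^ (m i - (j : ℕ) - 1) * ∏ p ∈ Finset.univ.erase i, n p ^ (m p - (j : ℕ))) *
        X ^ (j : ℕ) := by
    intro j
    rw [← hprod, map_prod]
    simp only [C_pow]
    ring
  simp only [hs, finsetSum_coeff, coeff_mul_X_pow', coeff_mul_C] at h
  rw [← Finset.add_sum_erase _ _ (Finset.mem_univ ℓ)] at h
  have h2 := (dvd_add_left (Finset.dvd_sum (s := Finset.univ.erase ℓ) (a := n i ^ (m i - (ℓ : ℕ)))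
    fun j hj => ?_)).1 h
  · rw [if_pos le_rfl, Nat.sub_self] at h2
    have e : m i - (ℓ : ℕ) = (m i - (ℓ : ℕ) - 1) + 1 := by have := ℓ.2; omega
    rw [mul_left_comm, e, pow_succ, Nat.add_sub_cancel] at h2
    have h3 := (mul_dvd_mul_iff_left (pow_ne_zero _ hi)).1 h2
    have h4 : IsRelPrime (n i) (∏ p ∈ Finset.univ.erase i, n p ^ (m p - (ℓ : ℕ))) :=
      IsRelPrime.prod_right fun p hp => ((hn (Finset.ne_of_mem_erase hp).symm).pow_right)
    have h5 := h4.dvd_of_dvd_mul_right h3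
    have := (mem_span_X_C_pow_iff (n i) 1 (r ℓ)).2 fun a => by
      cases a with
      | zero => simpa using h5
      | succ a => simp
    simpa using this
  · split_ifs with hle
    · have hne : (j : ℕ) ≠ ℓ := fun h => Finset.ne_of_mem_erase hj (Fin.ext h)
      refine Dvd.dvd.mul_left (Dvd.dvd.mul_right (pow_dvd_pow _ ?_) _) _
      have := ℓ.2
      omega
    · exact dvd_zero _

/-! ### Ideals of fat points and generation modulo `I_Z` -/

namespace P1xP1

/-- Lifts the condition from `R / I_Z` to `R`; `hle` is needed because the preimage of the image of
`I_{Z'}` is `I_{Z'} + I_Z`. -/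
theorem generatesSeparators_iff {k : Type*} [Field k] (Z : FatPoints k) (p : Line k × Line k)
    (hle : fatIdeal Z ≤ fatIdeal (reduceAt Z p)) {n : ℕ} (F : Fin n → CoordRing k) :
    GeneratesSeparators Z p F ↔ (∀ j, F j ∈ fatIdeal (reduceAt Z p)) ∧
      ∀ f ∈ fatIdeal (reduceAt Z p), ∃ s : Fin n → CoordRing k,
        f - ∑ j, s j * F j ∈ fatIdeal Z := by
  set I := fatIdeal Z
  set J := fatIdeal (reduceAt Z p)
  have hmk : ∀ f, Ideal.Quotient.mk I f ∈ J.map (Ideal.Quotient.mk I) ↔ f ∈ J := by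
    intro f
    rw [← Ideal.mem_comap, Ideal.comap_map_of_surjective _ Ideal.Quotient.mk_surjective,
      ← RingHom.ker_eq_comap_bot, Ideal.mk_ker, sup_eq_left.2 hle]
  have hsp : ∀ f, Ideal.Quotient.mk I f ∈
      Ideal.span (Set.range fun j => Ideal.Quotient.mk I (F j)) ↔
      ∃ s : Fin n → CoordRing k, f - ∑ j, s j * F j ∈ I := by
    intro f
    rw [Ideal.mem_span_range_iff_exists_fun]
    constructor
    · rintro ⟨c, hc⟩
      choose s hs using fun j => Ideal.Quotient.mk_surjective (c j)
      refine ⟨s, ?_⟩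
      rw [← Ideal.Quotient.eq, ← hc, map_sum]
      simp [hs]
    · rintro ⟨s, hs⟩
      refine ⟨fun j => Ideal.Quotient.mk I (s j), ?_⟩
      rw [← Ideal.Quotient.eq] at hs
      rw [hs, map_sum]
      simp
  constructor
  · intro h
    have h' : Ideal.span (Set.range fun j => Ideal.Quotient.mk I (F j)) =
      J.map (Ideal.Quotient.mk I) := h
    refine ⟨fun j => ?_, fun f hf => ?_⟩
    · rw [← hmk, ← h']
      exact Ideal.subset_span ⟨j, rfl⟩
    · rw [← hsp, h', hmk]
      exact hf
  · rintro ⟨h1, h2⟩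
    refine le_antisymm (Ideal.span_le.2 ?_) fun x hx => ?_
    · rintro _ ⟨j, rfl⟩
      exact (hmk _).2 (h1 j)
    · obtain ⟨f, rfl⟩ := Ideal.Quotient.mk_surjective x
      exact (hsp f).2 (h2 f ((hmk f).1 hx))

theorem sum_single_apply {k : Type*} [Field k] {b : ℕ} (pt : Fin b → Line k × Line k)
    (hpt : Function.Injective pt) (m : Fin b → ℕ) (q : Fin b) :
    (∑ p, Finsupp.single (pt p) (m p)) (pt q) = m q := by
  classical
  rw [Finsupp.finsetSum_apply, Finset.sum_eq_single q]
  · simp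
  · intro p _ hp
    exact Finsupp.single_eq_of_ne (fun h => hp (hpt h.symm))
  · simp

/-- Zero multiplicities are harmless, their power being the unit ideal; this matters since reducing
at a point of multiplicity one removes it from the support. -/
theorem fatIdeal_sum_single {k : Type*} [Field k] {b : ℕ} (pt : Fin b → Line k × Line k)
    (hpt : Function.Injective pt) (m : Fin b → ℕ) :
    fatIdeal (∑ p, Finsupp.single (pt p) (m p)) = ⨅ q, pointIdeal (pt q) ^ m q := by
  classical
  have hv := sum_single_apply pt hpt m
  refine le_antisymm (le_iInf fun q => ?_) (le_iInf₂ fun x hx => ?_)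
  · by_cases h : m q = 0
    · simp [h]
    · refine (iInf₂_le (pt q) ?_).trans (by rw [hv])
      rw [Finsupp.mem_support_iff, hv]
      exact h
  · obtain ⟨q, hq⟩ : ∃ q, pt q = x := by
      by_contra! hne
      rw [Finsupp.mem_support_iff, Finsupp.finsetSum_apply] at hx
      exact hx (Finset.sum_eq_zero fun p _ => Finsupp.single_eq_of_ne (hne p).symm)
    subst hq
    rw [hv]
    exact iInf_le _ q

theorem reduceAt_sum_single {k : Type*} [Field k] {b : ℕ} (pt : Fin b → Line k × Line k)
    (hpt : Function.Injective pt) (m : Fin b → ℕ) (i : Fin b) :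
    reduceAt (∑ p, Finsupp.single (pt p) (m p)) (pt i) =
      ∑ p, Finsupp.single (pt p) (if p = i then m p - 1 else m p) := by
  classical
  ext x
  rw [reduceAt, Finsupp.tsub_apply]
  by_cases hx : ∃ q, pt q = x
  · obtain ⟨q, rfl⟩ := hx
    rw [sum_single_apply pt hpt, sum_single_apply pt hpt]
    split_ifs with h
    · simp [h]
    · rw [Finsupp.single_eq_of_ne (fun h' => h (hpt h')), Nat.sub_zero]
  · push Not at hx
    have h0 : ∀ m' : Fin b → ℕ, (∑ p, Finsupp.single (pt p) (m' p)) x = 0 := fun m' => by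
      rw [Finsupp.finsetSum_apply]
      exact Finset.sum_eq_zero fun p _ => Finsupp.single_eq_of_ne (hx p).symm
    rw [h0, h0, Nat.zero_sub]

/-! ### The torus action, which detects bidegrees -/

/-- The action of `(s, t)` on the coordinate ring: `xᵢ ↦ s xᵢ` and `yᵢ ↦ t yᵢ`. -/
noncomputable def torusAction {k : Type*} [Field k] (s t : k) : CoordRing k →ₐ[k] CoordRing k :=
  MvPolynomial.aeval fun v =>
    MvPolynomial.C (s ^ (bidegree v).1 * t ^ (bidegree v).2) * MvPolynomial.X v

theorem torusAction_of_isBihomogeneous {k : Type*} [Field k] (s t : k) {F : CoordRing k}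
    {d : ℕ × ℕ} (hF : IsBihomogeneous F d) :
    torusAction s t F = MvPolynomial.C (s ^ d.1 * t ^ d.2) * F := by
  conv_lhs => rw [F.as_sum]
  conv_rhs => rw [F.as_sum]
  rw [map_sum, Finset.mul_sum]
  refine Finset.sum_congr rfl fun u hu => ?_
  have hd := hF (MvPolynomial.mem_support_iff.1 hu)
  rw [torusAction, MvPolynomial.aeval_monomial, MvPolynomial.monomial_eq,
    MvPolynomial.algebraMap_eq]
  simp only [mul_pow]
  rw [Finsupp.prod_mul, mul_left_comm]
  have e : (u.prod fun v n => (MvPolynomial.C (s ^ (bidegree v).1 * t ^ (bidegree v).2) :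
      CoordRing k) ^ n) = MvPolynomial.C (s ^ d.1 * t ^ d.2) := by
    rw [← hd, Finsupp.weight_apply, Finsupp.sum, Prod.fst_sum, Prod.snd_sum, Finsupp.prod,
      ← Finset.prod_pow_eq_pow_sum, ← Finset.prod_pow_eq_pow_sum, ← Finset.prod_mul_distrib,
      map_prod]
    refine Finset.prod_congr rfl fun v _ => ?_
    rw [← MvPolynomial.C_pow]
    simp only [Prod.smul_fst, Prod.smul_snd, smul_eq_mul]
    congr 1
    ring
  rw [e]

theorem constantCoeff_torusAction {k : Type*} [Field k] (s t : k) (F : CoordRing k) :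
    MvPolynomial.constantCoeff (torusAction s t F) = MvPolynomial.constantCoeff F := by
  have : (MvPolynomial.constantCoeff).comp (torusAction s t).toRingHom =
      (MvPolynomial.constantCoeff : CoordRing k →+* k) := by
    refine MvPolynomial.ringHom_ext (fun c => ?_) fun v => ?_ <;> simp [torusAction]
  exact RingHom.congr_fun this F


/-! ### Coordinates adapted to a line -/

/-- The linear form in the variables `some 0`, `some 1` that vanishes at `Q`. -/
noncomputable def lineForm {k : Type*} [Field k] (Q : Line k) : MvPolynomial (Option (Fin 2)) k :=
  MvPolynomial.C (Q.rep 1) * MvPolynomial.X (some 0)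
    - MvPolynomial.C (Q.rep 0) * MvPolynomial.X (some 1)

theorem isRelPrime_X_X {σ k : Type*} [Field k] {u v : σ} (huv : u ≠ v) :
    IsRelPrime (MvPolynomial.X u : MvPolynomial σ k) (MvPolynomial.X v) := by
  classical
  refine (MvPolynomial.X_prime (R := k) (i := u)).irreducible.isRelPrime_iff_not_dvd.2 ?_
  rintro ⟨c, hc⟩
  have := congrArg (MvPolynomial.eval (Pi.single v (1 : k))) hc
  simp [Pi.single_eq_of_ne huv] at this

/-- By Cramer's rule, a common divisor of the two forms divides both variables, the determinant `D`
being a unit. -/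
theorem isRelPrime_lineForm {k : Type*} [Field k] {P Q : Line k} (h : P ≠ Q) :
    IsRelPrime (lineForm P) (lineForm Q) := by
  intro d hP hQ
  have hd : P.rep 1 * Q.rep 0 - P.rep 0 * Q.rep 1 ≠ 0 := fun h0 =>
    h ((line_eq_iff P Q).1 h0).symm
  set D := P.rep 1 * Q.rep 0 - P.rep 0 * Q.rep 1
  have hu : IsUnit (MvPolynomial.C D : MvPolynomial (Option (Fin 2)) k) :=
    (isUnit_iff_ne_zero.2 hd).map _
  refine isRelPrime_X_X (k := k) (u := some (0 : Fin 2)) (v := some 1) (by simp) ?_ ?_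
  · refine (hu.dvd_mul_left).1 ?_
    have : MvPolynomial.C D * MvPolynomial.X (some (0 : Fin 2)) =
        MvPolynomial.C (Q.rep 0) * lineForm P - MvPolynomial.C (P.rep 0) * lineForm Q := by
      simp only [D, lineForm, map_sub, map_mul]; ring
    rw [this]
    exact dvd_sub (hP.mul_left _) (hQ.mul_left _)
  · refine (hu.dvd_mul_left).1 ?_
    have : MvPolynomial.C D * MvPolynomial.X (some (1 : Fin 2)) =
        MvPolynomial.C (Q.rep 1) * lineForm P - MvPolynomial.C (P.rep 1) * lineForm Q := by
      simp only [D, lineForm, map_sub, map_mul]; ring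
    rw [this]
    exact dvd_sub (hP.mul_left _) (hQ.mul_left _)

theorem rep_zero_or_rep_one_ne_zero {k : Type*} [Field k] (P : Line k) :
    P.rep 0 ≠ 0 ∨ P.rep 1 ≠ 0 := by
  by_contra! hc
  exact P.rep_nonzero (by ext j; fin_cases j <;> simp [hc.1, hc.2])

theorem lineForm_ne_zero {k : Type*} [Field k] (Q : Line k) : lineForm Q ≠ 0 := by
  intro h
  have h0 := congrArg (MvPolynomial.eval (fun v => if v = some 0 then (1 : k) else 0)) h
  have h1 := congrArg (MvPolynomial.eval (fun v => if v = some 1 then (1 : k) else 0)) h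
  simp [lineForm] at h0 h1
  exact (rep_zero_or_rep_one_ne_zero Q).elim (fun h => h h1) (fun h => h h0)

open Polynomial in
/-- Coordinates in which `L_P` is the variable of a polynomial ring in one variable, with the
forms `L_Q` of degree `(0, 1)` among the constants. -/
theorem exists_ringEquiv_formX {k : Type*} [Field k] (P : Line k) :
    ∃ e : CoordRing k ≃+* (MvPolynomial (Option (Fin 2)) k)[X],
      e (formX P) = X ∧ ∀ Q : Line k, e (formY Q) = C (lineForm Q) := by
  -- Then `q0 x₀ + q1 x₁`, the image of `X none` under `ψ`, completes `L_P` to a basis of the linear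
  -- forms in `x₀, x₁` with determinant one.
  obtain ⟨q0, q1, hq⟩ : ∃ q0 q1 : k, P.rep 1 * q1 + P.rep 0 * q0 = 1 := by
    rcases rep_zero_or_rep_one_ne_zero P with h | h
    · exact ⟨(P.rep 0)⁻¹, 0, by simp [h]⟩
    · exact ⟨0, (P.rep 1)⁻¹, by simp [h]⟩
  obtain ⟨φ, hφC, hφ0, hφ1, hφy⟩ : ∃ φ : CoordRing k →+* (MvPolynomial (Option (Fin 2)) k)[X],
      (∀ c, φ (MvPolynomial.C c) = C (MvPolynomial.C c)) ∧
      φ (MvPolynomial.X (Sum.inl 0)) = C (MvPolynomial.C q1) * X +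
        C (MvPolynomial.C (P.rep 0)) * C (MvPolynomial.X none) ∧
      φ (MvPolynomial.X (Sum.inl 1)) = -C (MvPolynomial.C q0) * X +
        C (MvPolynomial.C (P.rep 1)) * C (MvPolynomial.X none) ∧
      ∀ j, φ (MvPolynomial.X (Sum.inr j)) = C (MvPolynomial.X (some j)) :=
    ⟨MvPolynomial.eval₂Hom (C.comp MvPolynomial.C) (Sum.elim
      ![C (MvPolynomial.C q1) * X + C (MvPolynomial.C (P.rep 0)) * C (MvPolynomial.X none),
      -C (MvPolynomial.C q0) * X + C (MvPolynomial.C (P.rep 1)) * C (MvPolynomial.X none)]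
      (fun j => C (MvPolynomial.X (some j)))), by simp, by simp, by simp, by simp⟩
  obtain ⟨ψ, hψC, hψn, hψs, hψX⟩ : ∃ ψ : (MvPolynomial (Option (Fin 2)) k)[X] →+* CoordRing k,
      (∀ c, ψ (C (MvPolynomial.C c)) = MvPolynomial.C c) ∧
      ψ (C (MvPolynomial.X none)) = MvPolynomial.C q0 * MvPolynomial.X (Sum.inl 0)
        + MvPolynomial.C q1 * MvPolynomial.X (Sum.inl 1) ∧
      (∀ j, ψ (C (MvPolynomial.X (some j))) = MvPolynomial.X (Sum.inr j)) ∧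
      ψ X = formX P :=
    ⟨eval₂RingHom (MvPolynomial.eval₂Hom MvPolynomial.C
      (fun o => o.elim (MvPolynomial.C q0 * MvPolynomial.X (Sum.inl 0)
        + MvPolynomial.C q1 * MvPolynomial.X (Sum.inl 1)) fun j => MvPolynomial.X (Sum.inr j)))
      (formX P), fun c => by rw [coe_eval₂RingHom, eval₂_C, MvPolynomial.eval₂Hom_C],
      by rw [coe_eval₂RingHom, eval₂_C, MvPolynomial.eval₂Hom_X', Option.elim_none],
      fun j => by rw [coe_eval₂RingHom, eval₂_C, MvPolynomial.eval₂Hom_X', Option.elim_some],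
      by rw [coe_eval₂RingHom, eval₂_X]⟩
  have hC := congrArg (fun c => (MvPolynomial.C c : CoordRing k)) hq
  have hCC := congrArg (fun c => (C (MvPolynomial.C c) : (MvPolynomial (Option (Fin 2)) k)[X])) hq
  simp only [map_add, map_mul, map_one] at hC hCC
  have hφX : φ (formX P) = X := by
    simp only [formX, map_sub, map_mul, hφC, hφ0, hφ1]
    linear_combination X * hCC
  have hφY : ∀ Q : Line k, φ (formY Q) = C (lineForm Q) := by
    intro Q
    simp only [formY, lineForm, map_sub, map_mul, hφC, hφy]
  refine ⟨RingEquiv.ofRingHom φ ψ ?_ ?_, hφX, hφY⟩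
  · refine Polynomial.ringHom_ext' (MvPolynomial.ringHom_ext (fun c => ?_) fun o => ?_) ?_
    · simp [hφC, hψC]
    · cases o with
      | none =>
        simp only [RingHom.comp_apply, hψn, map_add, map_mul, hφC, hφ0, hφ1, RingHom.id_apply]
        linear_combination (C (MvPolynomial.X none)) * hCC
      | some j => simp [hψs, hφy]
    · simp [hψX, hφX]
  · refine MvPolynomial.ringHom_ext (fun c => ?_) fun v => ?_
    · simp [hφC, hψC]
    · rcases v with j | j
      · fin_cases j
        · simp only [RingHom.comp_apply, Fin.zero_eta, hφ0, map_add, map_mul, hψC, hψX, hψn, formX,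
            RingHom.id_apply]
          linear_combination MvPolynomial.X (Sum.inl 0) * hC
        · simp only [RingHom.comp_apply, Fin.mk_one, hφ1, map_add, map_mul, map_neg, hψC, hψX, hψn,
            formX, RingHom.id_apply]
          linear_combination MvPolynomial.X (Sum.inl 1) * hC
      · simp [hψs, hφy]

open Polynomial in
theorem exists_ringEquiv_formY {k : Type*} [Field k] (P : Line k) :
    ∃ e : CoordRing k ≃+* (MvPolynomial (Option (Fin 2)) k)[X],
      e (formY P) = X ∧ ∀ Q : Line k, e (formX Q) = C (lineForm Q) := by
  obtain ⟨e, hX, hY⟩ := exists_ringEquiv_formX P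
  let σ := (MvPolynomial.renameEquiv k (Equiv.sumComm (Fin 2) (Fin 2))).toRingEquiv
  have h1 : ∀ Q : Line k, σ (formY Q) = formX Q := fun Q => by simp [σ, formX, formY]
  have h2 : ∀ Q : Line k, σ (formX Q) = formY Q := fun Q => by simp [σ, formX, formY]
  refine ⟨σ.trans e, ?_, fun Q => ?_⟩
  · rw [RingEquiv.trans_apply, h1, hX]
  · rw [RingEquiv.trans_apply, h2, hY]


/-! ### Minimality and uniqueness of degrees -/

/-- If `S * T = 1`, then `T` has at least as many rows as columns, and a square `T` has a
transversal of nonzero entries. -/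
theorem le_and_exists_perm_of_mul_eq_one {k : Type*} [Field k] {m n : ℕ}
    (S : Matrix (Fin m) (Fin n) k) (T : Matrix (Fin n) (Fin m) k) (h : S * T = 1) :
    m ≤ n ∧ ∀ hmn : m = n, ∃ σ : Equiv.Perm (Fin n), ∀ j, T j ((finCongr hmn).symm (σ j)) ≠ 0 := by
  refine ⟨?_, ?_⟩
  · have h1 := Matrix.rank_mul_le_left S T
    rw [h, Matrix.rank_one, Fintype.card_fin] at h1
    exact h1.trans (by simpa using S.rank_le_width)
  · rintro rfl
    have hdet : T.det ≠ 0 := by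
      intro h0
      have := congrArg Matrix.det h
      rw [Matrix.det_mul, h0, mul_zero, Matrix.det_one] at this
      exact zero_ne_one this
    rw [← Matrix.det_transpose, Matrix.det_apply] at hdet
    obtain ⟨σ, -, hσ⟩ := Finset.exists_ne_zero_of_sum_ne_zero hdet
    refine ⟨σ, fun j h0 => hσ ?_⟩
    rw [Finset.prod_eq_zero (Finset.mem_univ j), smul_zero]
    simpa using h0

/-- A criterion for minimality of separators and for uniqueness of their degrees. -/
theorem minimalSeparators_of_independent {k : Type*} [Field k] [CharZero k] (Z : FatPoints k)
    (p : Line k × Line k) (hle : fatIdeal Z ≤ fatIdeal (reduceAt Z p)) {m : ℕ}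
    (F : Fin m → CoordRing k) (D : Fin m → ℕ × ℕ) (hD : ∀ ℓ, IsBihomogeneous (F ℓ) (D ℓ))
    (hF : GeneratesSeparators Z p F)
    (hind : ∀ r : Fin m → CoordRing k, ∑ ℓ, r ℓ * F ℓ ∈ fatIdeal Z →
      ∀ ℓ, MvPolynomial.constantCoeff (r ℓ) = 0)
    (htorus : ∀ s t : k, ∀ f ∈ fatIdeal Z, torusAction s t f ∈ fatIdeal Z) :
    IsMinimalSeparators Z p F ∧ ∀ E : Multiset (ℕ × ℕ), IsSeparatorDegree Z p E ↔
      E = (Finset.univ : Finset (Fin m)).val.map D := by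
  have hF' := (generatesSeparators_iff Z p hle F).1 hF
  have key : ∀ {n : ℕ} (G : Fin n → CoordRing k), GeneratesSeparators Z p G →
      ∃ r : Fin n → Fin m → CoordRing k, (∀ j, G j - ∑ ℓ, r j ℓ * F ℓ ∈ fatIdeal Z) ∧
        m ≤ n ∧ ∀ hmn : m = n, ∃ σ : Equiv.Perm (Fin n), ∀ j,
          MvPolynomial.constantCoeff (r j ((finCongr hmn).symm (σ j))) ≠ 0 := by
    intro n G hG
    rw [generatesSeparators_iff Z p hle] at hG
    choose r hr using fun j => hF'.2 _ (hG.1 j)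
    choose s hs using fun ℓ => hG.2 _ (hF'.1 ℓ)
    refine ⟨r, hr, le_and_exists_perm_of_mul_eq_one
      (Matrix.of fun ℓ j => MvPolynomial.constantCoeff (s ℓ j))
      (Matrix.of fun j ℓ => MvPolynomial.constantCoeff (r j ℓ)) ?_⟩
    ext a c
    -- Substituting the expressions of the `G j` into that of `F a` gives a relation among the `F
    -- ℓ`; its constant terms are the entries of `1 - S * T`.
    have h := hind (fun ℓ => (if a = ℓ then 1 else 0) - ∑ j, s a j * r j ℓ) (by
      have e : ∑ ℓ, ((if a = ℓ then 1 else 0) - ∑ j, s a j * r j ℓ) * F ℓ =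
          (F a - ∑ j, s a j * G j) + ∑ j, s a j * (G j - ∑ ℓ, r j ℓ * F ℓ) := by
        simp only [sub_mul, Finset.sum_sub_distrib, mul_sub, ite_mul, one_mul, zero_mul,
          Finset.sum_ite_eq, Finset.mem_univ, if_true, Finset.sum_mul, Finset.mul_sum, mul_assoc]
        rw [Finset.sum_comm]
        ring
      rw [e]
      exact add_mem (hs a) (Ideal.sum_mem _ fun j _ => Ideal.mul_mem_left _ _ (hr j))) c
    rw [map_sub, sub_eq_zero] at h
    rw [Matrix.mul_apply, Matrix.one_apply]
    simp only [Matrix.of_apply, ← map_mul, ← map_sum]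
    rw [← h]
    split_ifs <;> simp
  have hmin : IsMinimalSeparators Z p F :=
    ⟨hF, fun q G hq hG => by obtain ⟨r, -, h, -⟩ := key G hG; omega⟩
  refine ⟨hmin, fun E => ⟨?_, fun hE => ⟨m, F, D, hmin, hD, hE⟩⟩⟩
  rintro ⟨n, G, d, ⟨hG, hGmin⟩, hd, rfl⟩
  obtain ⟨r, hr, hmn, hperm⟩ := key G hG
  obtain rfl : m = n := le_antisymm hmn (not_lt.1 fun h => hGmin m F h hF)
  obtain ⟨σ, hσ⟩ := hperm rfl
  have hdeg : ∀ j ℓ, MvPolynomial.constantCoeff (r j ℓ) ≠ 0 → d j = D ℓ := by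
    intro j ℓ hne
    -- Rescale the expression of `G j` by the torus and subtract `s^(d j).1 t^(d j).2` times the
    -- original: `G j` cancels, and independence compares the two characters on the nonzero constant
    -- term of `r j ℓ`.
    have hchar : ∀ s t : k, s ^ (D ℓ).1 * t ^ (D ℓ).2 = s ^ (d j).1 * t ^ (d j).2 := by
      intro s t
      have h := hind (fun ℓ => MvPolynomial.C (s ^ (d j).1 * t ^ (d j).2) * r j ℓ -
        torusAction s t (r j ℓ) * MvPolynomial.C (s ^ (D ℓ).1 * t ^ (D ℓ).2)) (by
          have h1 := htorus s t _ (hr j)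
          rw [map_sub, torusAction_of_isBihomogeneous s t (hd j), map_sum] at h1
          simp only [map_mul (torusAction s t), torusAction_of_isBihomogeneous s t (hD _)] at h1
          have h2 := sub_mem h1 (Ideal.mul_mem_left _
            (MvPolynomial.C (s ^ (d j).1 * t ^ (d j).2)) (hr j))
          convert h2 using 1
          simp only [sub_mul, Finset.sum_sub_distrib, mul_sub, Finset.mul_sum, mul_assoc]
          ring) ℓ
      simp only [map_sub, map_mul, constantCoeff_torusAction, MvPolynomial.constantCoeff_C,
        sub_eq_zero] at h
      rw [mul_comm] at h
      simpa [mul_pow] using (mul_left_cancel₀ hne h).symm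
    -- In characteristic zero the powers of `2` are distinct, so two values of the characters
    -- recover the bidegree.
    have h1 := hchar 2 1
    have h2 := hchar 1 2
    simp only [one_pow, mul_one, one_mul] at h1 h2
    exact Prod.ext (Nat.pow_right_injective le_rfl (by exact_mod_cast h1.symm))
      (Nat.pow_right_injective le_rfl (by exact_mod_cast h2.symm))
  have : d = D ∘ σ := funext fun j => hdeg j (σ j) (by simpa using hσ j)
  rw [this, ← Multiset.map_map]
  congr 1
  simp


/-! ### Separators of points on a line -/

theorem IsBihomogeneous.mul {k : Type*} [Field k] {F G : CoordRing k} {d e : ℕ × ℕ}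
    (hF : IsBihomogeneous F d) (hG : IsBihomogeneous G e) : IsBihomogeneous (F * G) (d + e) :=
  MvPolynomial.IsWeightedHomogeneous.mul hF hG

theorem IsBihomogeneous.pow {k : Type*} [Field k] {F : CoordRing k} {d : ℕ × ℕ}
    (hF : IsBihomogeneous F d) (n : ℕ) : IsBihomogeneous (F ^ n) (n • d) :=
  MvPolynomial.IsWeightedHomogeneous.pow hF n

/-- The bound `hℓ` keeps the summand at `i` positive, so lowering it really lowers the sum by one.
-/
theorem sum_reduced_multiplicities {b : ℕ} (m : Fin b → ℕ) (i : Fin b) {ℓ : ℕ} (hℓ : ℓ < m i) :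
    ∑ p, (if p = i then m p - ℓ - 1 else m p - ℓ) = ∑ p, (m p - ℓ) - 1 := by
  rw [← Finset.add_sum_erase _ _ (Finset.mem_univ i),
    ← Finset.add_sum_erase _ (fun p => m p - ℓ) (Finset.mem_univ i), if_pos rfl,
    Finset.sum_congr rfl fun p hp => if_neg (Finset.ne_of_mem_erase hp)]
  omega

theorem isBihomogeneous_separator {k : Type*} [Field k] {b : ℕ} {L : CoordRing k}
    {N : Fin b → CoordRing k} {dL dN : ℕ × ℕ} (hL : IsBihomogeneous L dL)
    (hN : ∀ q, IsBihomogeneous (N q) dN) (m : Fin b → ℕ) (i : Fin b) {ℓ : ℕ} (hℓ : ℓ < m i) :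
    IsBihomogeneous (L ^ ℓ * ∏ p, N p ^ (if p = i then m p - ℓ - 1 else m p - ℓ))
      (ℓ • dL + (∑ p, (m p - ℓ) - 1) • dN) := by
  refine (hL.pow ℓ).mul ?_
  rw [← sum_reduced_multiplicities m i hℓ, Finset.sum_smul]
  exact MvPolynomial.IsWeightedHomogeneous.prod _ _ _ fun p _ => (hN p).pow _

theorem separator_mem_span_pow {R : Type*} [CommRing R] {b : ℕ} (L : R) (N : Fin b → R)
    (m : Fin b → ℕ) (i q : Fin b) (ℓ : ℕ) :
    L ^ ℓ * ∏ p, N p ^ (if p = i then m p - ℓ - 1 else m p - ℓ) ∈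
      Ideal.span {L, N q} ^ (if q = i then m q - 1 else m q) := by
  rw [← Finset.mul_prod_erase _ _ (Finset.mem_univ q), ← mul_assoc]
  refine Ideal.mul_mem_right _ _ (pow_mul_pow_mem_span_pair_pow _ _ ?_)
  split_ifs <;> omega

theorem torusAction_mem_span_pair_pow {k : Type*} [Field k] {L N : CoordRing k} {dL dN : ℕ × ℕ}
    (hL : IsBihomogeneous L dL) (hN : IsBihomogeneous N dN) (s t : k) (n : ℕ) {f : CoordRing k}
    (hf : f ∈ Ideal.span {L, N} ^ n) : torusAction s t f ∈ Ideal.span {L, N} ^ n := by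
  have h : Ideal.map (torusAction s t) (Ideal.span {L, N}) ≤ Ideal.span {L, N} := by
    rw [Ideal.map_span, Ideal.span_le]
    rintro _ ⟨x, hx, rfl⟩
    rcases hx with rfl | rfl
    · rw [torusAction_of_isBihomogeneous s t hL]
      exact Ideal.mul_mem_left _ _ (Ideal.subset_span (by simp))
    · rw [torusAction_of_isBihomogeneous s t hN]
      exact Ideal.mul_mem_left _ _ (Ideal.subset_span (by simp))
  have h2 := Ideal.mem_map_of_mem (torusAction s t) hf
  rw [Ideal.map_pow] at h2
  exact Ideal.pow_right_mono h n h2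

theorem constantCoeff_eq_zero_of_mem_span_pair {k : Type*} [Field k] {L N f : CoordRing k}
    (hL : MvPolynomial.constantCoeff L = 0) (hN : MvPolynomial.constantCoeff N = 0)
    (hf : f ∈ Ideal.span {L, N}) : MvPolynomial.constantCoeff f = 0 := by
  obtain ⟨u, v, rfl⟩ := Ideal.mem_span_pair.1 hf
  simp [hL, hN]

open Polynomial in
/-- The separators of a fat point on a line `L = 0`, with the points on the line cut out by the
forms `N q`. -/
theorem separators_of_points_on_line {k : Type*} [Field k] [CharZero k] {A : Type*} [CommRing A]
    [IsDomain A] [UniqueFactorizationMonoid A] {b : ℕ} (pt : Fin b → Line k × Line k)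
    (hpt : Function.Injective pt) {L : CoordRing k} {N : Fin b → CoordRing k}
    (hI : ∀ q, pointIdeal (pt q) = Ideal.span {L, N q}) (e : CoordRing k ≃+* A[X]) (n : Fin b → A)
    (heL : e L = X) (heN : ∀ q, e (N q) = C (n q))
    (hn : Pairwise fun p q => IsRelPrime (n p) (n q)) (hn0 : ∀ q, n q ≠ 0) {dL dN : ℕ × ℕ}
    (hL : IsBihomogeneous L dL) (hN : ∀ q, IsBihomogeneous (N q) dN)
    (hL0 : MvPolynomial.constantCoeff L = 0) (hN0 : ∀ q, MvPolynomial.constantCoeff (N q) = 0)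
    (m : Fin b → ℕ) (i : Fin b) (F : Fin (m i) → CoordRing k)
    (hF : ∀ ℓ, F ℓ = L ^ (ℓ : ℕ) *
      ∏ p, N p ^ (if p = i then m p - (ℓ : ℕ) - 1 else m p - (ℓ : ℕ))) :
    (∀ ℓ, IsSeparator (∑ p, Finsupp.single (pt p) (m p)) (pt i) (F ℓ)) ∧
    IsMinimalSeparators (∑ p, Finsupp.single (pt p) (m p)) (pt i) F ∧
    ∀ E : Multiset (ℕ × ℕ), IsSeparatorDegree (∑ p, Finsupp.single (pt p) (m p)) (pt i) E ↔
      E = (Multiset.range (m i)).map fun ℓ => ℓ • dL + (∑ p, (m p - ℓ) - 1) • dN := by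
  have htr : ∀ q c f, f ∈ pointIdeal (pt q) ^ c ↔ e f ∈ Ideal.span {(X : A[X]), C (n q)} ^ c := by
    intro q c f
    have : Ideal.span {(X : A[X]), C (n q)} ^ c = (pointIdeal (pt q) ^ c).map e := by
      rw [Ideal.map_pow, hI, Ideal.map_span, Set.image_pair, heL, heN]
    rw [this, Ideal.mem_map_of_equiv]
    exact ⟨fun h => ⟨f, h, rfl⟩, fun ⟨x, hx, h⟩ => e.injective h ▸ hx⟩
  have heF : ∀ ℓ, e (F ℓ) = X ^ (ℓ : ℕ) *
      ∏ p, C (n p) ^ (if p = i then m p - (ℓ : ℕ) - 1 else m p - (ℓ : ℕ)) := by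
    intro ℓ
    simp only [hF, map_mul, map_pow, map_prod, heL, heN]
  have hZ : ∀ f, f ∈ fatIdeal (∑ p, Finsupp.single (pt p) (m p)) ↔
      ∀ q, f ∈ pointIdeal (pt q) ^ m q := by
    intro f
    rw [fatIdeal_sum_single pt hpt, Ideal.mem_iInf]
  have hZ' : ∀ f, f ∈ fatIdeal (reduceAt (∑ p, Finsupp.single (pt p) (m p)) (pt i)) ↔
      ∀ q, f ∈ pointIdeal (pt q) ^ (if q = i then m q - 1 else m q) := by
    intro f
    rw [reduceAt_sum_single pt hpt, fatIdeal_sum_single pt hpt, Ideal.mem_iInf]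
  have hle : fatIdeal (∑ p, Finsupp.single (pt p) (m p)) ≤
      fatIdeal (reduceAt (∑ p, Finsupp.single (pt p) (m p)) (pt i)) := by
    intro f hf
    rw [hZ] at hf
    rw [hZ']
    exact fun q => Ideal.pow_le_pow_right (by split_ifs <;> omega) (hf q)
  have hFmem : ∀ ℓ q, F ℓ ∈ pointIdeal (pt q) ^ (if q = i then m q - 1 else m q) := by
    intro ℓ q
    rw [hI, hF]
    exact separator_mem_span_pow L N m i q ℓ
  -- Only membership at the point `i` is assumed, so the same fact also yields `F ℓ ∉ I^(m i)`
  -- there.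
  have hind : ∀ r : Fin (m i) → CoordRing k, ∑ ℓ, r ℓ * F ℓ ∈ pointIdeal (pt i) ^ m i →
      ∀ ℓ, MvPolynomial.constantCoeff (r ℓ) = 0 := by
    intro r hr ℓ
    rw [htr, map_sum] at hr
    simp only [map_mul, heF] at hr
    have h := mem_span_of_sum_mem_span_X_C_pow n hn m i (hn0 i) (fun ℓ => e (r ℓ)) hr ℓ
    rw [← pow_one (Ideal.span _), ← htr, pow_one, hI] at h
    exact constantCoeff_eq_zero_of_mem_span_pair hL0 (hN0 i) h
  have hgen : GeneratesSeparators (∑ p, Finsupp.single (pt p) (m p)) (pt i) F := by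
    rw [generatesSeparators_iff _ _ hle]
    refine ⟨fun ℓ => (hZ' _).2 (hFmem ℓ), fun f hf => ?_⟩
    rw [hZ'] at hf
    obtain ⟨r, hr⟩ := exists_sub_sum_mem_iInf_span_X_C n hn m i (e f) fun q => (htr _ _ _).1 (hf q)
    refine ⟨fun ℓ => e.symm (r ℓ), (hZ _).2 fun q => (htr _ _ _).2 ?_⟩
    simpa only [map_sub, map_sum, map_mul, heF, RingEquiv.apply_symm_apply] using hr q
  have htorus : ∀ s t : k, ∀ f ∈ fatIdeal (∑ p, Finsupp.single (pt p) (m p)),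
      torusAction s t f ∈ fatIdeal (∑ p, Finsupp.single (pt p) (m p)) := by
    intro s t f hf
    rw [hZ] at hf ⊢
    intro q
    have h := hf q
    rw [hI] at h ⊢
    exact torusAction_mem_span_pair_pow hL (hN q) s t _ h
  obtain ⟨hmin, hdeg⟩ := minimalSeparators_of_independent _ (pt i) hle F _
    (fun ℓ => by rw [hF ℓ]; exact isBihomogeneous_separator hL hN m i ℓ.2) hgen
    (fun r hr => hind r ((hZ _).1 hr i)) htorus
  refine ⟨fun ℓ => ⟨?_, fun h => ?_, fun q hq hne => ?_⟩, hmin, fun E => ?_⟩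
  · rw [sum_single_apply pt hpt]
    simpa using hFmem ℓ i
  · rw [sum_single_apply pt hpt] at h
    -- If `F ℓ` vanished to order `m i`, it would be a relation with coefficient `1`, whose constant
    -- term is not zero.
    have := hind (Pi.single ℓ 1) (by simpa [Pi.single_apply] using h) ℓ
    simp at this
  · obtain ⟨p, rfl⟩ : ∃ p, pt p = q := by
      by_contra! hq'
      rw [Finsupp.mem_support_iff, Finsupp.finsetSum_apply] at hq
      exact hq (Finset.sum_eq_zero fun p _ => Finsupp.single_eq_of_ne (hq' p).symm)
    rw [sum_single_apply pt hpt]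
    have := hFmem ℓ p
    rwa [if_neg fun h => hne (by rw [h])] at this
  · have h : Multiset.range (m i) = (Finset.univ : Finset (Fin (m i))).val.map Fin.val :=
      (congrArg ((↑) : List ℕ → Multiset ℕ) (List.map_coe_finRange_eq_range (n := m i))).symm
    rw [hdeg, h, Multiset.map_map]
    rfl

end P1xP1

theorem mainTheorem2 {k : Type*} [Field k] [IsAlgClosed k] [CharZero k] {b : ℕ}
    (P : P1xP1.Line k) (Q : Fin b → P1xP1.Line k) (hQ : Function.Injective Q)
    (m : Fin b → ℕ) (hm : ∀ p, 0 < m p) (i : Fin b)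
    (B : ℕ → ℕ) (hB : ∀ ℓ, B ℓ = ∑ p, (m p - ℓ)) :
    -- all the points have the same first coordinate
    (∀ Z : P1xP1.FatPoints k, Z = ∑ p, Finsupp.single (P, Q p) (m p) →
      (∀ D : Multiset (ℕ × ℕ), P1xP1.IsSeparatorDegree Z (P, Q i) D ↔
        D = (Multiset.range (m i)).map fun ℓ => (ℓ, B ℓ - 1)) ∧
      ∀ F : Fin (m i) → P1xP1.CoordRing k,
        (∀ ℓ, F ℓ = P1xP1.formX P ^ (ℓ : ℕ) *
          ∏ p, P1xP1.formY (Q p) ^ (if p = i then m p - (ℓ : ℕ) - 1 else m p - (ℓ : ℕ))) →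
        (∀ ℓ, P1xP1.IsBihomogeneous (F ℓ) ((ℓ : ℕ), B ℓ - 1)) ∧
        (∀ ℓ, P1xP1.IsSeparator Z (P, Q i) (F ℓ)) ∧
        P1xP1.IsMinimalSeparators Z (P, Q i) F) ∧
    -- all the points have the same second coordinate
    (∀ Z : P1xP1.FatPoints k, Z = ∑ p, Finsupp.single (Q p, P) (m p) →
      (∀ D : Multiset (ℕ × ℕ), P1xP1.IsSeparatorDegree Z (Q i, P) D ↔
        D = (Multiset.range (m i)).map fun ℓ => (B ℓ - 1, ℓ)) ∧
      ∀ F : Fin (m i) → P1xP1.CoordRing k,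
        (∀ ℓ, F ℓ = P1xP1.formY P ^ (ℓ : ℕ) *
          ∏ p, P1xP1.formX (Q p) ^ (if p = i then m p - (ℓ : ℕ) - 1 else m p - (ℓ : ℕ))) →
        (∀ ℓ, P1xP1.IsBihomogeneous (F ℓ) (B ℓ - 1, (ℓ : ℕ))) ∧
        (∀ ℓ, P1xP1.IsSeparator Z (Q i, P) (F ℓ)) ∧
        P1xP1.IsMinimalSeparators Z (Q i, P) F) := by
  open P1xP1 in
  have hX0 : ∀ S : Line k, MvPolynomial.constantCoeff (formX S) = 0 := fun S => by simp [formX]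
  have hY0 : ∀ S : Line k, MvPolynomial.constantCoeff (formY S) = 0 := fun S => by simp [formY]
  have hn : Pairwise fun p q => IsRelPrime (lineForm (Q p)) (lineForm (Q q)) :=
    fun p q hpq => isRelPrime_lineForm fun h => hpq (hQ h)
  refine ⟨?_, ?_⟩
  · rintro _ rfl
    obtain ⟨e, heL, heN⟩ := exists_ringEquiv_formX P
    have main := separators_of_points_on_line (fun p => (P, Q p))
      (fun p q h => hQ (congrArg Prod.snd h)) (L := formX P) (N := fun q => formY (Q q))
      (fun q => rfl) e (fun q => lineForm (Q q)) heL
      (fun q => heN _) hn (fun q => lineForm_ne_zero _) (formX_isBihomogeneous P)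
      (fun q => formY_isBihomogeneous _) (hX0 P) (fun q => hY0 _) m i
    refine ⟨fun D => ?_, fun F hF => ?_⟩
    · rw [(main _ fun ℓ => rfl).2.2 D]
      simp [hB]
    · obtain ⟨h1, h2, -⟩ := main F hF
      refine ⟨fun ℓ => ?_, h1, h2⟩
      rw [hF ℓ]
      simpa [hB] using isBihomogeneous_separator (formX_isBihomogeneous P)
        (fun q => formY_isBihomogeneous (Q q)) m i ℓ.2
  · rintro _ rfl
    obtain ⟨e, heL, heN⟩ := exists_ringEquiv_formY P
    have main := separators_of_points_on_line (fun p => (Q p, P))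
      (fun p q h => hQ (congrArg Prod.fst h)) (L := formY P) (N := fun q => formX (Q q))
      (fun q => by rw [pointIdeal, Set.pair_comm]) e
      (fun q => lineForm (Q q)) heL
      (fun q => heN _) hn (fun q => lineForm_ne_zero _) (formY_isBihomogeneous P)
      (fun q => formX_isBihomogeneous _) (hY0 P) (fun q => hX0 _) m i
    refine ⟨fun D => ?_, fun F hF => ?_⟩
    · rw [(main _ fun ℓ => rfl).2.2 D]
      simp [hB]
    · obtain ⟨h1, h2, -⟩ := main F hF
      refine ⟨fun ℓ => ?_, h1, h2⟩
      rw [hF ℓ]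
      simpa [hB] using isBihomogeneous_separator (formY_isBihomogeneous P)
        (fun q => formX_isBihomogeneous (Q q)) m i ℓ.2
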